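/- For $t>0$ and $x,y\in\mathbb{R}^d$ let $g(t,x,y)=(4\pi t)^{-d/2}e^{-|y-x|^2/(4t)}$. For a Borel function $V:\mathbb{R}^d\to\mathbb{R}$, the Schrödinger perturbation of $g$ by $V$ (the fundamental solution of $\partial_t=\Delta+V$) is the function $G:(0,\infty)\times\mathbb{R}^d\times\mathbb{R}^d\to\mathbb{R}$ determined by the Duhamel formula $$G(t,x,y)=g(t,x,y)+\int_0^t\int_{\mathbb{R}^d}G(s,x,z)\,V(z)\,g(t-s,z,y)\,dz\,ds,\qquad t>0,\ x,y\in\mathbb{R}^d,$$ that is, $G$ satisfies this formula, with absolutely convergent integrals, for all $t,x,y$, and it is the only function that does. We say that $V$ has the global sharp Gaussian estimates if this $G$ exists and there are numbers $0<c_1\le c_2<\infty$ such that $$c_1\le\frac{G(t,x,y)}{g(t,x,y)}\le c_2\qquad\text{for all } t>0,\ x,y\in\mathbb{R}^d.$$ Corollary. For every integer $d\ge 3$ there is a Borel function $V:\mathbb{R}^d\to(-\infty,0]$ which has the global sharp Gaussian estimates, but such that $V\notin L^1(\mathbb{R}^d)$ and $V\notin L^p_{\mathrm{loc}}(\mathbb{R}^d)$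 for every $p\in(1,\infty]$. For every integer $d\ge 3$ there is also a Borel function $V:\mathbb{R}^d\to[0,\infty)$ with the same properties. -/

import Mathlib

open MeasureTheory Set
open scoped ENNReal

noncomputable section

/-- The Gauss-Weierstrass kernel
`g(t, x, y) = (4 π t)^(-d/2) exp (-|y - x|² / (4 t))` on `ℝ^d`, for `t > 0`. -/
def gaussWeierstrass (d : ℕ) (t : ℝ) (x y : EuclideanSpace ℝ (Fin d)) : ℝ :=
  (4 * Real.pi * t) ^ (-(d : ℝ) / 2) * Real.exp (-‖y - x‖ ^ 2 / (4 * t))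

/-- The Duhamel (perturbation) formula: for all `t > 0` and `x, y ∈ ℝ^d`,
`G(t, x, y) = g(t, x, y) + ∫_0^t ∫_{ℝ^d} G(s, x, z) V(z) g(t - s, z, y) dz ds`,
where the space-time integral converges absolutely. -/
def SatisfiesDuhamel {d : ℕ} (V : EuclideanSpace ℝ (Fin d) → ℝ)
    (G : ℝ → EuclideanSpace ℝ (Fin d) → EuclideanSpace ℝ (Fin d) → ℝ) : Prop :=
  ∀ t : ℝ, 0 < t → ∀ x y : EuclideanSpace ℝ (Fin d),
    IntegrableOn
      (fun q : ℝ × EuclideanSpace ℝ (Fin d) =>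
        G q.1 x q.2 * V q.2 * gaussWeierstrass d (t - q.1) q.2 y)
      (Ioo 0 t ×ˢ univ) volume ∧
    G t x y = gaussWeierstrass d t x y +
      ∫ s in Ioo 0 t, ∫ z, G s x z * V z * gaussWeierstrass d (t - s) z y

/-- `G` is the Schrödinger perturbation of the Gauss-Weierstrass kernel by `V` (the fundamental
solution of `∂_t = Δ + V`): it is determined by the Duhamel formula, i.e. it satisfies the formula
and every solution of the formula agrees with it on `(0, ∞) × ℝ^d × ℝ^d`. -/
def IsSchrodingerPerturbation {d : ℕ} (V : EuclideanSpace ℝ (Fin d) → ℝ)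
    (G : ℝ → EuclideanSpace ℝ (Fin d) → EuclideanSpace ℝ (Fin d) → ℝ) : Prop :=
  SatisfiesDuhamel V G ∧
  ∀ G' : ℝ → EuclideanSpace ℝ (Fin d) → EuclideanSpace ℝ (Fin d) → ℝ,
    SatisfiesDuhamel V G' → ∀ t : ℝ, 0 < t → ∀ x y, G' t x y = G t x y

/-- The global sharp Gaussian estimates for `V`: the Schrödinger perturbation `G` of `g` by `V`
exists, and `c₁ ≤ G / g ≤ c₂` on `(0, ∞) × ℝ^d × ℝ^d` for some `0 < c₁ ≤ c₂ < ∞`. -/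
def HasGlobalSharpGaussianEstimates {d : ℕ} (V : EuclideanSpace ℝ (Fin d) → ℝ) : Prop :=
  ∃ G : ℝ → EuclideanSpace ℝ (Fin d) → EuclideanSpace ℝ (Fin d) → ℝ,
    IsSchrodingerPerturbation V G ∧
    ∃ c₁ c₂ : ℝ, 0 < c₁ ∧ c₁ ≤ c₂ ∧
      ∀ t : ℝ, 0 < t → ∀ x y : EuclideanSpace ℝ (Fin d),
        c₁ ≤ G t x y / gaussWeierstrass d t x y ∧ G t x y / gaussWeierstrass d t x y ≤ c₂

/-- `V ∈ L^p_loc(ℝ^d)`: the restriction of `V` to every compact set is in `L^p`. -/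
def MemLpLoc {d : ℕ} (V : EuclideanSpace ℝ (Fin d) → ℝ) (p : ℝ≥0∞) : Prop :=
  ∀ K : Set (EuclideanSpace ℝ (Fin d)), IsCompact K → MemLp V p (volume.restrict K)

end

/-! Everything reduces to one smallness condition, `BridgePotentialLE V η`: the integral of `|V|`
along the Gaussian bridge from `x` to `y` is at most `η`, uniformly in `t`, `x`, `y`. If `η < 1/2`,
the perturbation series is dominated by `∑ η^n g`, so its sum `G` solves Duhamel's formula and `|G -
g| ≤ η/(1-η) g` with `η/(1-η) < 1`. The same condition turns Duhamel's formula into a contraction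
for the difference of two solutions, whence uniqueness (`SatisfiesDuhamel.eq_of_bridgePotentialLE`).
Only `|V|` enters, so both signs are treated at once.

By the bridge identity, the time-`s` marginal of the bridge is a heat kernel at time `s(t-s)/t`. A
box of width `r` in two coordinates and `R` in a third has heat mass at most `min(1, r/√τ)² min(1,
R/√τ)`, which integrates in time to a multiple of `r²(1 + log(R/r))`
(`lintegral_bridge_indicator_le`). The third coordinate makes the integral converge at infinity;
this is where `d ≥ 3` is needed.

The length `R` thus costs only a logarithm. With `r = 2⁻ⁿ`, `R = 2ⁿ` and height of order `4ⁿ/n³`,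
the bridge contributions are of order `1/n²`, while the `L¹` mass of the `n`-th box grows like
`2ⁿ/n³`, and its part near the origin contributes about `4^(n(p-1))/n^(3p)` to the integral of
`V^p`. -/

/-! ### Heat kernel: bridge identity and mass of boxes -/

theorem gaussWeierstrass_pos {d : ℕ} {t : ℝ} (ht : 0 < t) (x y : EuclideanSpace ℝ (Fin d)) :
    0 < gaussWeierstrass d t x y := by
  unfold gaussWeierstrass
  have := Real.pi_pos
  positivity

theorem Measurable.gaussWeierstrass {d : ℕ} {α : Type*} [MeasurableSpace α] {f : α → ℝ}
    {g h : α → EuclideanSpace ℝ (Fin d)} (hf : Measurable f) (hg : Measurable g)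
    (hh : Measurable h) : Measurable fun a => gaussWeierstrass d (f a) (g a) (h a) := by
  unfold _root_.gaussWeierstrass
  fun_prop

/-- The Gaussian bridge identity. -/
theorem gaussWeierstrass_mul_gaussWeierstrass {d : ℕ} {s t : ℝ} (hs : 0 < s) (hst : s < t)
    (x y z : EuclideanSpace ℝ (Fin d)) :
    gaussWeierstrass d s x z * gaussWeierstrass d (t - s) z y =
      gaussWeierstrass d t x y *
        gaussWeierstrass d (s * (t - s) / t) (x + (s / t) • (y - x)) z := by
  have hpi := Real.pi_pos
  have ht : 0 < t := hs.trans hst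
  have hts : 0 < t - s := sub_pos.2 hst
  unfold gaussWeierstrass
  rw [mul_mul_mul_comm, mul_mul_mul_comm ((4 * Real.pi * t) ^ _), ← Real.exp_add, ← Real.exp_add,
    ← Real.mul_rpow (by positivity) (by positivity),
    ← Real.mul_rpow (by positivity) (by positivity)]
  congr 2
  · field_simp
  · obtain ⟨a, rfl⟩ : ∃ a, z = x + a := ⟨z - x, by simp⟩
    obtain ⟨b, rfl⟩ : ∃ b, y = x + b := ⟨y - x, by simp⟩
    simp only [add_sub_cancel_left, add_sub_add_left_eq_sub]
    rw [norm_sub_sq_real, norm_sub_sq_real, real_inner_smul_right, norm_smul, real_inner_comm,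
      mul_pow, Real.norm_eq_abs, sq_abs]
    field_simp
    ring

theorem gaussWeierstrass_eq_prod {d : ℕ} {t : ℝ} (ht : 0 < t) (x y : EuclideanSpace ℝ (Fin d)) :
    gaussWeierstrass d t x y =
      ∏ i, ProbabilityTheory.gaussianPDFReal (x i) (2 * t).toNNReal (y i) := by
  have hpi := Real.pi_pos
  unfold gaussWeierstrass ProbabilityTheory.gaussianPDFReal
  rw [Finset.prod_mul_distrib, ← Real.exp_sum, Finset.prod_const, Finset.card_univ,
    Fintype.card_fin, EuclideanSpace.norm_sq_eq]
  congr 1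
  · rw [Real.coe_toNNReal _ (by positivity), Real.sqrt_eq_rpow, ← Real.rpow_neg (by positivity), ← Real.rpow_natCast,
      ← Real.rpow_mul (by positivity)]
    congr 1 <;> ring
  · congr 1
    rw [neg_div, Finset.sum_div, ← Finset.sum_neg_distrib]
    refine Finset.sum_congr rfl fun i _ => ?_
    simp only [PiLp.sub_apply, Real.norm_eq_abs, sq_abs,
      Real.coe_toNNReal (2 * t) (by positivity)]
    ring

theorem setLIntegral_gaussianPDFReal_le_one (m t : ℝ) (ht : 0 < t) (s : Set ℝ) :
    ∫⁻ u in s, ENNReal.ofReal (ProbabilityTheory.gaussianPDFReal m (2 * t).toNNReal u) ≤ 1 := by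
  have hv : (2 * t).toNNReal ≠ 0 := by simpa using ht
  rw [← ProbabilityTheory.lintegral_gaussianPDFReal_eq_one m hv]
  exact setLIntegral_le_lintegral _ _

/-- The density is at most `1/√(4πt) ≤ 1/(2√t)`, and the interval has length `2r`. -/
theorem setLIntegral_gaussianPDFReal_Ioo_le (m t : ℝ) (ht : 0 < t) (r : ℝ) :
    ∫⁻ u in Ioo (-r) r,
      ENNReal.ofReal (ProbabilityTheory.gaussianPDFReal m (2 * t).toNNReal u) ≤
      ENNReal.ofReal (min 1 (r / √t)) := by
  rw [ENNReal.ofReal_min, le_min_iff]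
  refine ⟨by simpa using setLIntegral_gaussianPDFReal_le_one m t ht _, ?_⟩
  have hst : 0 < √t := Real.sqrt_pos.2 ht
  have hb : ∀ u, ProbabilityTheory.gaussianPDFReal m (2 * t).toNNReal u ≤ 1 / (2 * √t) := by
    intro u
    unfold ProbabilityTheory.gaussianPDFReal
    rw [Real.coe_toNNReal _ (by positivity), ← one_div]
    have h1 : 2 * √t ≤ √(2 * Real.pi * (2 * t)) := by
      apply Real.le_sqrt_of_sq_le
      rw [mul_pow, Real.sq_sqrt ht.le]
      nlinarith [Real.pi_gt_three]
    have h2 : Real.exp (-(u - m) ^ 2 / (2 * (2 * t))) ≤ 1 := by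
      rw [Real.exp_le_one_iff]
      exact div_nonpos_of_nonpos_of_nonneg (neg_nonpos.2 (sq_nonneg _)) (by positivity)
    calc _ ≤ 1 / √(2 * Real.pi * (2 * t)) * 1 := by gcongr
      _ ≤ 1 / (2 * √t) := by rw [mul_one]; gcongr
  calc _ ≤ ∫⁻ u in Ioo (-r) r, ENNReal.ofReal (1 / (2 * √t)) :=
        lintegral_mono fun u => ENNReal.ofReal_le_ofReal (hb u)
    _ = ENNReal.ofReal (r / √t) := by
        rw [setLIntegral_const, Real.volume_Ioo, ← ENNReal.ofReal_mul (by positivity)]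
        congr 1
        field_simp
        ring

/-- Heat kernel mass of a product of coordinate sets. -/
theorem setLIntegral_gaussWeierstrass_pi {d : ℕ} {t : ℝ} (ht : 0 < t)
    (x : EuclideanSpace ℝ (Fin d)) (s : Fin d → Set ℝ) (hs : ∀ i, MeasurableSet (s i)) :
    ∫⁻ z in {z : EuclideanSpace ℝ (Fin d) | ∀ i, z i ∈ s i},
        ENNReal.ofReal (gaussWeierstrass d t x z) =
      ∏ i, ∫⁻ u in s i,
        ENNReal.ofReal (ProbabilityTheory.gaussianPDFReal (x i) (2 * t).toNNReal u) := by
  have h1 : ∀ z : EuclideanSpace ℝ (Fin d), ENNReal.ofReal (gaussWeierstrass d t x z) =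
      ∏ i, ENNReal.ofReal
        (ProbabilityTheory.gaussianPDFReal (x i) (2 * t).toNNReal (z.ofLp i)) := by
    intro z
    rw [gaussWeierstrass_eq_prod ht, ENNReal.ofReal_prod_of_nonneg]
    exact fun i _ => ProbabilityTheory.gaussianPDFReal_nonneg _ _ _
  have hm : MeasurableSet (univ.pi s) := MeasurableSet.univ_pi hs
  have h2 : {z : EuclideanSpace ℝ (Fin d) | ∀ i, z i ∈ s i} =
      (WithLp.ofLp : EuclideanSpace ℝ (Fin d) → Fin d → ℝ) ⁻¹' univ.pi s := by
    ext z; simp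
  rw [lintegral_congr h1, h2,
    (PiLp.volume_preserving_ofLp (Fin d)).setLIntegral_comp_preimage
      (f := fun w : Fin d → ℝ => ∏ i, ENNReal.ofReal
        (ProbabilityTheory.gaussianPDFReal (x i) (2 * t).toNNReal (w i))) hm (by fun_prop),
    volume_pi, Measure.restrict_pi_pi]
  have hi : ∀ i, Integrable (ProbabilityTheory.gaussianPDFReal (x i) (2 * t).toNNReal)
      (volume.restrict (s i)) :=
    fun i => (ProbabilityTheory.integrable_gaussianPDFReal _ _).restrict
  have hn : ∀ i u, 0 ≤ ProbabilityTheory.gaussianPDFReal (x i) (2 * t).toNNReal u :=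
    fun i u => ProbabilityTheory.gaussianPDFReal_nonneg _ _ _
  simp_rw [← fun i => ofReal_integral_eq_lintegral_ofReal (hi i) (ae_of_all _ (hn i))]
  rw [← ENNReal.ofReal_prod_of_nonneg fun i _ => integral_nonneg (hn i),
    ← integral_fintype_prod_eq_prod, ofReal_integral_eq_lintegral_ofReal
      (Integrable.fintype_prod hi) (ae_of_all _ fun w => Finset.prod_nonneg fun i _ => hn i (w i))]
  exact lintegral_congr fun w => (ENNReal.ofReal_prod_of_nonneg fun i _ => hn i (w i)).symm

/-- Heat kernel mass of a set thin in two coordinates and bounded in a third one. -/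
theorem setLIntegral_gaussWeierstrass_le {d : ℕ} {t : ℝ} (ht : 0 < t)
    (x : EuclideanSpace ℝ (Fin d)) {i j k : Fin d} (hij : i ≠ j) (hik : i ≠ k) (hjk : j ≠ k)
    {r R : ℝ} (hr : 0 ≤ r) {A : Set (EuclideanSpace ℝ (Fin d))}
    (hA : ∀ z ∈ A, |z i| < r ∧ |z j| < r ∧ |z k| < R) :
    ∫⁻ z in A, ENNReal.ofReal (gaussWeierstrass d t x z) ≤
      ENNReal.ofReal (min 1 (r / √t) ^ 2 * min 1 (R / √t)) := by
  classical
  let s : Fin d → Set ℝ := fun l =>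
    if l = i then Ioo (-r) r else if l = j then Ioo (-r) r else if l = k then Ioo (-R) R else univ
  -- Three separate factors, each equal to `1` off a single index, so that the product over `l`
  -- evaluates termwise.
  let b : Fin d → ENNReal := fun l =>
    (if l = i then ENNReal.ofReal (min 1 (r / √t)) else 1) *
    (if l = j then ENNReal.ofReal (min 1 (r / √t)) else 1) *
    (if l = k then ENNReal.ofReal (min 1 (R / √t)) else 1)
  have hs : ∀ l, MeasurableSet (s l) := by
    intro l
    dsimp only [s]
    split_ifs <;> measurability
  have hAs : A ⊆ {z : EuclideanSpace ℝ (Fin d) | ∀ l, z l ∈ s l} := by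
    intro z hz l
    obtain ⟨h1, h2, h3⟩ := hA z hz
    rw [abs_lt] at h1 h2 h3
    dsimp only [s]
    split_ifs with h h h
    · exact h ▸ h1
    · exact h ▸ h2
    · exact h ▸ h3
    · trivial
  have h1r : 0 ≤ min 1 (r / √t) := le_min zero_le_one (by positivity)
  calc _ ≤ ∏ l, ∫⁻ u in s l,
        ENNReal.ofReal (ProbabilityTheory.gaussianPDFReal (x l) (2 * t).toNNReal u) := by
        rw [← setLIntegral_gaussWeierstrass_pi ht x s hs]
        exact lintegral_mono_set hAs
    _ ≤ ∏ l, b l := by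
        refine Finset.prod_le_prod' fun l _ => ?_
        dsimp only [s, b]
        by_cases hi : l = i
        · subst hi
          simpa [hij, hik] using setLIntegral_gaussianPDFReal_Ioo_le (x l) t ht r
        by_cases hj : l = j
        · subst hj
          simpa [hij.symm, hjk] using setLIntegral_gaussianPDFReal_Ioo_le (x l) t ht r
        by_cases hk : l = k
        · subst hk
          simpa [hik.symm, hjk.symm] using setLIntegral_gaussianPDFReal_Ioo_le (x l) t ht R
        simpa [hi, hj, hk] using setLIntegral_gaussianPDFReal_le_one (x l) t ht univ
    _ = _ := by
        simp only [b, Finset.prod_mul_distrib, Finset.prod_ite_eq', Finset.mem_univ, if_true]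
        rw [ENNReal.ofReal_mul (by positivity), ENNReal.ofReal_pow h1r, sq]

/-! ### Existence: the perturbation series -/

noncomputable section

variable {d : ℕ}

/-- The absolute bridge potential of `V` over `(0, t)` is at most `η`. -/
def BridgePotentialLE (V : EuclideanSpace ℝ (Fin d) → ℝ) (η : ℝ) : Prop :=
  ∀ t : ℝ, 0 < t → ∀ x y : EuclideanSpace ℝ (Fin d),
    ∫⁻ q in Ioo 0 t ×ˢ univ, ENNReal.ofReal
      (gaussWeierstrass d q.1 x q.2 * |V q.2| * gaussWeierstrass d (t - q.1) q.2 y) ≤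
    ENNReal.ofReal (η * gaussWeierstrass d t x y)

/-- The terms of the perturbation series started at `x`. -/
def perturbationTerm (V : EuclideanSpace ℝ (Fin d) → ℝ) (x : EuclideanSpace ℝ (Fin d)) :
    ℕ → ℝ × EuclideanSpace ℝ (Fin d) → ℝ
  | 0 => fun p => gaussWeierstrass d p.1 x p.2
  | n + 1 => fun p => ∫ q in Ioo 0 p.1 ×ˢ univ,
      perturbationTerm V x n q * V q.2 * gaussWeierstrass d (p.1 - q.1) q.2 p.2

variable {V : EuclideanSpace ℝ (Fin d) → ℝ}

theorem measurable_perturbationTerm (hV : Measurable V) (x : EuclideanSpace ℝ (Fin d)) (n : ℕ) :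
    Measurable (perturbationTerm V x n) := by
  induction n with
  | zero =>
    exact Measurable.gaussWeierstrass measurable_fst measurable_const measurable_snd
  | succ n ih =>
    have hm : Measurable fun r : (ℝ × EuclideanSpace ℝ (Fin d)) × (ℝ × EuclideanSpace ℝ (Fin d)) =>
        perturbationTerm V x n r.2 * V r.2.2 *
          gaussWeierstrass d (r.1.1 - r.2.1) r.2.2 r.1.2 :=
      ((ih.comp measurable_snd).mul (hV.comp (by fun_prop))).mul
        (Measurable.gaussWeierstrass (by fun_prop) (by fun_prop) (by fun_prop))
    -- The domain of integration depends on `p`; an indicator makes it fixed, as measurability of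
    -- parametric integrals requires.
    have hS : MeasurableSet {r : (ℝ × EuclideanSpace ℝ (Fin d)) ×
        (ℝ × EuclideanSpace ℝ (Fin d)) | r.2.1 ∈ Ioo 0 r.1.1} :=
      (measurableSet_lt (measurable_const (a := (0 : ℝ))) (measurable_fst.comp measurable_snd)).inter
        (measurableSet_lt (measurable_fst.comp measurable_snd)
          (measurable_fst.comp measurable_fst))
    have h := (hm.indicator hS).stronglyMeasurable.integral_prod_right' (ν := volume)
    convert h.measurable using 1
    ext p
    simp only [perturbationTerm]
    rw [← integral_indicator (measurableSet_Ioo.prod MeasurableSet.univ)]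
    refine integral_congr_ae (ae_of_all _ fun q => ?_)
    simp [indicator]

/-- One Duhamel step multiplies a Gaussian bound `c` by `η`; this drives all estimates of the
series. -/
theorem lintegral_enorm_mul_gaussWeierstrass_le (hV : Measurable V) {η : ℝ}
    (h : BridgePotentialLE V η) {x : EuclideanSpace ℝ (Fin d)}
    {f : ℝ × EuclideanSpace ℝ (Fin d) → ℝ} {c : ℝ} (hc : 0 ≤ c)
    (hf : ∀ t, 0 < t → ∀ y, |f (t, y)| ≤ c * gaussWeierstrass d t x y)
    {t : ℝ} (ht : 0 < t) (y : EuclideanSpace ℝ (Fin d)) :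
    ∫⁻ q in Ioo 0 t ×ˢ univ, ‖f q * V q.2 * gaussWeierstrass d (t - q.1) q.2 y‖ₑ ≤
      ENNReal.ofReal (c * η * gaussWeierstrass d t x y) := by
  calc _ ≤ ∫⁻ q in Ioo 0 t ×ˢ univ, ENNReal.ofReal c * ENNReal.ofReal
        (gaussWeierstrass d q.1 x q.2 * |V q.2| * gaussWeierstrass d (t - q.1) q.2 y) := by
        refine setLIntegral_mono' (measurableSet_Ioo.prod MeasurableSet.univ) fun q hq => ?_
        have hq1 : 0 < q.1 := hq.1.1
        have hq2 : 0 < t - q.1 := sub_pos.2 hq.1.2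
        have hg := gaussWeierstrass_pos hq2 q.2 y
        rw [← ENNReal.ofReal_mul hc, ← ofReal_norm, norm_mul, norm_mul, Real.norm_eq_abs,
          Real.norm_eq_abs, Real.norm_eq_abs, abs_of_pos hg]
        refine ENNReal.ofReal_le_ofReal ?_
        rw [← mul_assoc, ← mul_assoc]
        gcongr
        exact hf q.1 hq1 q.2
    _ ≤ ENNReal.ofReal c * ENNReal.ofReal (η * gaussWeierstrass d t x y) := by
        rw [lintegral_const_mul _ (by
          refine Measurable.ennreal_ofReal ?_
          exact ((Measurable.gaussWeierstrass (by fun_prop) (by fun_prop) (by fun_prop)).mul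
            (hV.comp measurable_snd).abs).mul
            (Measurable.gaussWeierstrass (by fun_prop) (by fun_prop) (by fun_prop)))]
        gcongr
        exact h t ht x y
    _ = _ := by rw [← ENNReal.ofReal_mul hc, mul_assoc]

theorem integrable_and_integral_norm_le (hV : Measurable V) {η : ℝ} (hη : 0 ≤ η)
    (h : BridgePotentialLE V η) {x : EuclideanSpace ℝ (Fin d)}
    {f : ℝ × EuclideanSpace ℝ (Fin d) → ℝ} (hfm : Measurable f) {c : ℝ} (hc : 0 ≤ c)
    (hf : ∀ t, 0 < t → ∀ y, |f (t, y)| ≤ c * gaussWeierstrass d t x y)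
    {t : ℝ} (ht : 0 < t) (y : EuclideanSpace ℝ (Fin d)) :
    IntegrableOn (fun q => f q * V q.2 * gaussWeierstrass d (t - q.1) q.2 y) (Ioo 0 t ×ˢ univ) ∧
    ∫ q in Ioo 0 t ×ˢ univ, ‖f q * V q.2 * gaussWeierstrass d (t - q.1) q.2 y‖ ≤
      c * η * gaussWeierstrass d t x y := by
  have hg := gaussWeierstrass_pos ht x y
  have hle := lintegral_enorm_mul_gaussWeierstrass_le hV h hc hf ht y
  have hm : Measurable fun q : ℝ × EuclideanSpace ℝ (Fin d) =>
      f q * V q.2 * gaussWeierstrass d (t - q.1) q.2 y :=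
    (hfm.mul (hV.comp measurable_snd)).mul
      (Measurable.gaussWeierstrass (by fun_prop) (by fun_prop) (by fun_prop))
  refine ⟨⟨hm.aestronglyMeasurable, hle.trans_lt ENNReal.ofReal_lt_top⟩, ?_⟩
  rw [integral_norm_eq_lintegral_enorm hm.aestronglyMeasurable]
  exact ENNReal.toReal_le_of_le_ofReal (by positivity) hle

theorem abs_perturbationTerm_le (hV : Measurable V) {η : ℝ} (hη : 0 ≤ η)
    (h : BridgePotentialLE V η) (x : EuclideanSpace ℝ (Fin d)) (n : ℕ) :
    ∀ t, 0 < t → ∀ y, |perturbationTerm V x n (t, y)| ≤ η ^ n * gaussWeierstrass d t x y := by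
  induction n with
  | zero =>
    intro t ht y
    rw [pow_zero, one_mul, perturbationTerm, abs_of_pos (gaussWeierstrass_pos ht x y)]
  | succ n ih =>
    intro t ht y
    rw [perturbationTerm, pow_succ]
    exact (norm_integral_le_integral_norm _).trans
      (integrable_and_integral_norm_le hV hη h (measurable_perturbationTerm hV x n)
        (pow_nonneg hη n) ih ht y).2

/-- The sum of the perturbation series. -/
def perturbationSeries (V : EuclideanSpace ℝ (Fin d) → ℝ) (t : ℝ)
    (x y : EuclideanSpace ℝ (Fin d)) : ℝ :=
  ∑' n, perturbationTerm V x n (t, y)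

theorem summable_perturbationTerm (hV : Measurable V) {η : ℝ} (hη : 0 ≤ η) (hη1 : η < 1)
    (h : BridgePotentialLE V η) (x : EuclideanSpace ℝ (Fin d)) {t : ℝ} (ht : 0 < t)
    (y : EuclideanSpace ℝ (Fin d)) : Summable fun n => perturbationTerm V x n (t, y) :=
  Summable.of_norm_bounded
    ((summable_geometric_of_lt_one hη hη1).mul_right (gaussWeierstrass d t x y))
    fun n => abs_perturbationTerm_le hV hη h x n t ht y

theorem measurable_perturbationSeries (hV : Measurable V) (x : EuclideanSpace ℝ (Fin d)) :
    Measurable fun p : ℝ × EuclideanSpace ℝ (Fin d) => perturbationSeries V p.1 x p.2 := by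
  unfold perturbationSeries
  exact Measurable.tsum fun n => measurable_perturbationTerm hV x n

theorem abs_perturbationSeries_sub_le (hV : Measurable V) {η : ℝ} (hη : 0 ≤ η) (hη1 : η < 1)
    (h : BridgePotentialLE V η) (x : EuclideanSpace ℝ (Fin d)) {t : ℝ} (ht : 0 < t)
    (y : EuclideanSpace ℝ (Fin d)) :
    |perturbationSeries V t x y - gaussWeierstrass d t x y| ≤
      η / (1 - η) * gaussWeierstrass d t x y := by
  have hs := summable_perturbationTerm hV hη hη1 h x ht y
  rw [perturbationSeries, hs.tsum_eq_zero_add, perturbationTerm, add_sub_cancel_left]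
  have hg : HasSum (fun n => η ^ (n + 1) * gaussWeierstrass d t x y)
      (η / (1 - η) * gaussWeierstrass d t x y) := by
    refine HasSum.mul_right _ ?_
    simp_rw [pow_succ']
    exact (hasSum_geometric_of_lt_one hη hη1).mul_left η
  rw [← Real.norm_eq_abs]
  exact tsum_of_norm_bounded hg fun n => abs_perturbationTerm_le hV hη h x (n + 1) t ht y

theorem abs_perturbationSeries_le (hV : Measurable V) {η : ℝ} (hη : 0 ≤ η) (hη1 : η < 1)
    (h : BridgePotentialLE V η) (x : EuclideanSpace ℝ (Fin d)) (t : ℝ) (ht : 0 < t)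
    (y : EuclideanSpace ℝ (Fin d)) :
    |perturbationSeries V t x y| ≤ (1 - η)⁻¹ * gaussWeierstrass d t x y := by
  rw [← Real.norm_eq_abs]
  exact tsum_of_norm_bounded ((hasSum_geometric_of_lt_one hη hη1).mul_right _)
    fun n => abs_perturbationTerm_le hV hη h x n t ht y

/-- Integrating the series term by term shifts its index by one; the exchange is allowed because the
integrals of the absolute values are dominated by a geometric series. -/
theorem satisfiesDuhamel_perturbationSeries (hV : Measurable V) {η : ℝ} (hη : 0 ≤ η)
    (hη1 : η < 1) (h : BridgePotentialLE V η) : SatisfiesDuhamel V (perturbationSeries V) := by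
  intro t ht x y
  have hint := (integrable_and_integral_norm_le hV hη h (x := x)
    (f := fun p => perturbationSeries V p.1 x p.2) (measurable_perturbationSeries hV x)
    (inv_nonneg.2 (sub_nonneg.2 hη1.le)) (abs_perturbationSeries_le hV hη hη1 h x) ht y).1
  refine ⟨hint, ?_⟩
  have hprod := setIntegral_prod (μ := (volume : Measure ℝ))
    (ν := (volume : Measure (EuclideanSpace ℝ (Fin d)))) _ hint
  simp only [Measure.restrict_univ] at hprod
  rw [← hprod]
  have hterm := fun n => integrable_and_integral_norm_le hV hη h
    (measurable_perturbationTerm hV x n) (pow_nonneg hη n) (abs_perturbationTerm_le hV hη h x n) ht y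
  have hsum := hasSum_integral_of_summable_integral_norm (fun n => (hterm n).1)
    (Summable.of_nonneg_of_le (fun n => integral_nonneg fun q => norm_nonneg _)
      (fun n => (hterm n).2)
      (((summable_geometric_of_lt_one hη hη1).mul_right η).mul_right (gaussWeierstrass d t x y)))
  rw [perturbationSeries, (summable_perturbationTerm hV hη hη1 h x ht y).tsum_eq_zero_add,
    perturbationTerm]
  congr 1
  refine Eq.trans hsum.tsum_eq ?_
  refine setIntegral_congr_fun (measurableSet_Ioo.prod MeasurableSet.univ) fun q hq => ?_
  have hq1 : 0 < q.1 := hq.1.1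
  exact ((((summable_perturbationTerm hV hη hη1 h x hq1 q.2).hasSum.mul_right _).mul_right _)).tsum_eq

end

/-! ### Uniqueness, and the criterion for sharp Gaussian estimates -/

noncomputable section

variable {d : ℕ} {V : EuclideanSpace ℝ (Fin d) → ℝ}

/-- The bridge estimate over the time interval `(a, t)`. -/
theorem BridgePotentialLE.lintegral_shift_le {η : ℝ} (h : BridgePotentialLE V η) {a t : ℝ}
    (hat : a < t) (x y : EuclideanSpace ℝ (Fin d)) :
    ∫⁻ q in Ioo a t ×ˢ univ, ENNReal.ofReal
      (gaussWeierstrass d (q.1 - a) x q.2 * |V q.2| * gaussWeierstrass d (t - q.1) q.2 y) ≤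
    ENNReal.ofReal (η * gaussWeierstrass d (t - a) x y) := by
  have : (volume : Measure (ℝ × EuclideanSpace ℝ (Fin d))).IsAddRightInvariant :=
    inferInstanceAs (((volume : Measure ℝ).prod
      (volume : Measure (EuclideanSpace ℝ (Fin d)))).IsAddRightInvariant)
  refine le_of_eq_of_le ?_ (h (t - a) (sub_pos.2 hat) x y)
  rw [← lintegral_indicator (measurableSet_Ioo.prod MeasurableSet.univ),
    ← lintegral_indicator (measurableSet_Ioo.prod MeasurableSet.univ),
    ← lintegral_add_right_eq_self _ ((a, 0) : ℝ × EuclideanSpace ℝ (Fin d))]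
  refine lintegral_congr fun q => ?_
  have : t - (q.1 + a) = t - a - q.1 := by ring
  simp [indicator, this, lt_sub_iff_add_lt]

/-- Tonelli: for fixed `r` the inner integral over `q` is a bridge potential on the time interval
`(r.1, t)`. -/
theorem lintegral_lintegral_bridge_le (hV : Measurable V) {η : ℝ} (hη : 0 ≤ η)
    (h : BridgePotentialLE V η) {t : ℝ} (y : EuclideanSpace ℝ (Fin d))
    {w : ℝ × EuclideanSpace ℝ (Fin d) → ℝ≥0∞}
    (hw : AEMeasurable w (volume.restrict (Ioo 0 t ×ˢ univ))) :
    ∫⁻ q in Ioo 0 t ×ˢ univ,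
      (∫⁻ r in Ioo 0 q.1 ×ˢ univ, w r * ENNReal.ofReal (gaussWeierstrass d (q.1 - r.1) r.2 q.2)) *
        ENNReal.ofReal (|V q.2| * gaussWeierstrass d (t - q.1) q.2 y) ≤
    ENNReal.ofReal η *
      ∫⁻ r in Ioo 0 t ×ˢ univ, w r * ENNReal.ofReal (gaussWeierstrass d (t - r.1) r.2 y) := by
  set S : Set (ℝ × EuclideanSpace ℝ (Fin d)) := Ioo 0 t ×ˢ univ with hSdef
  have hS : MeasurableSet S := measurableSet_Ioo.prod MeasurableSet.univ
  -- The indicator encodes the order of times, so that both integrals run over the same set `S` and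
  -- can be swapped.
  let k : ℝ × EuclideanSpace ℝ (Fin d) → ℝ × EuclideanSpace ℝ (Fin d) → ℝ≥0∞ := fun q r =>
    (Ioo r.1 t ×ˢ univ : Set (ℝ × EuclideanSpace ℝ (Fin d))).indicator (fun q => ENNReal.ofReal
      (gaussWeierstrass d (q.1 - r.1) r.2 q.2 * |V q.2| * gaussWeierstrass d (t - q.1) q.2 y)) q
  have hk : Measurable (Function.uncurry k) := by
    have hm : Measurable fun p : (ℝ × EuclideanSpace ℝ (Fin d)) × (ℝ × EuclideanSpace ℝ (Fin d)) =>
        ENNReal.ofReal (gaussWeierstrass d (p.1.1 - p.2.1) p.2.2 p.1.2 * |V p.1.2| *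
          gaussWeierstrass d (t - p.1.1) p.1.2 y) := by
      refine Measurable.ennreal_ofReal ?_
      exact ((Measurable.gaussWeierstrass (by fun_prop) (by fun_prop) (by fun_prop)).mul
        (hV.comp (by fun_prop)).abs).mul
        (Measurable.gaussWeierstrass (by fun_prop) (by fun_prop) (by fun_prop))
    have hs : MeasurableSet {p : (ℝ × EuclideanSpace ℝ (Fin d)) ×
        (ℝ × EuclideanSpace ℝ (Fin d)) | p.1.1 ∈ Ioo p.2.1 t} :=
      (measurableSet_lt (measurable_fst.comp measurable_snd)
        (measurable_fst.comp measurable_fst)).inter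
        (measurableSet_lt (measurable_fst.comp measurable_fst) (measurable_const (a := t)))
    convert hm.indicator hs using 1
    ext ⟨q, r⟩
    simp [k, indicator, Function.uncurry]
  have hk1 : ∀ q, Measurable (k q) := fun q => hk.comp measurable_prodMk_left
  have hk2 : ∀ r, Measurable fun q => k q r := fun r => hk.comp measurable_prodMk_right
  calc _ ≤ ∫⁻ q in S, ∫⁻ r in S, w r * k q r := by
        refine setLIntegral_mono' hS fun q hq => ?_
        have hsub : (Ioo 0 q.1 ×ˢ univ : Set (ℝ × EuclideanSpace ℝ (Fin d))) ⊆ S :=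
          prod_mono (Ioo_subset_Ioo_right hq.1.2.le) Subset.rfl
        rw [← lintegral_mul_const' _ _ ENNReal.ofReal_ne_top]
        refine le_trans (setLIntegral_mono' (measurableSet_Ioo.prod MeasurableSet.univ)
          fun r hr => ?_) (lintegral_mono_set hsub)
        have hg := gaussWeierstrass_pos (sub_pos.2 hr.1.2) r.2 q.2
        have hmem : q ∈ (Ioo r.1 t ×ˢ univ : Set (ℝ × EuclideanSpace ℝ (Fin d))) :=
          ⟨⟨hr.1.2, hq.1.2⟩, trivial⟩
        simp only [k, indicator_of_mem hmem]
        rw [mul_assoc, ← ENNReal.ofReal_mul hg.le, mul_assoc]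
    _ = ∫⁻ r in S, ∫⁻ q in S, w r * k q r := by
        refine lintegral_lintegral_swap ?_
        exact (hw.comp_snd).mul hk.aemeasurable
    _ ≤ ∫⁻ r in S, ENNReal.ofReal η *
          (w r * ENNReal.ofReal (gaussWeierstrass d (t - r.1) r.2 y)) := by
        refine setLIntegral_mono' hS fun r hr => ?_
        rw [lintegral_const_mul _ (hk2 r), mul_left_comm, ← ENNReal.ofReal_mul hη]
        gcongr
        refine le_trans (setLIntegral_le_lintegral _ _) ?_
        rw [lintegral_indicator (measurableSet_Ioo.prod MeasurableSet.univ)]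
        exact h.lintegral_shift_le hr.1.2 r.2 y
    _ = _ := lintegral_const_mul' _ _ ENNReal.ofReal_ne_top

/-- The potential `u` of `|G' - G| |V|` is finite by absolute convergence and dominates `|G' - G|`.
Inserting this bound into `u` itself gives `u ≤ η u`, hence `u = 0`. No Gaussian bound on the two
solutions is assumed. -/
theorem SatisfiesDuhamel.eq_of_bridgePotentialLE (hV : Measurable V) {η : ℝ} (hη : 0 ≤ η)
    (hη1 : η < 1) (h : BridgePotentialLE V η)
    {G G' : ℝ → EuclideanSpace ℝ (Fin d) → EuclideanSpace ℝ (Fin d) → ℝ}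
    (hG : SatisfiesDuhamel V G) (hG' : SatisfiesDuhamel V G') {t : ℝ} (ht : 0 < t)
    (x y : EuclideanSpace ℝ (Fin d)) : G' t x y = G t x y := by
  let w : ℝ × EuclideanSpace ℝ (Fin d) → ℝ≥0∞ := fun r => ‖(G' r.1 x r.2 - G r.1 x r.2) * V r.2‖ₑ
  let u : ℝ → EuclideanSpace ℝ (Fin d) → ℝ≥0∞ := fun t y =>
    ∫⁻ r in Ioo 0 t ×ˢ univ, w r * ENNReal.ofReal (gaussWeierstrass d (t - r.1) r.2 y)
  have hS : ∀ t : ℝ, MeasurableSet (Ioo 0 t ×ˢ univ : Set (ℝ × EuclideanSpace ℝ (Fin d))) :=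
    fun t => measurableSet_Ioo.prod MeasurableSet.univ
  have hint : ∀ t, 0 < t → ∀ y, IntegrableOn (fun q : ℝ × EuclideanSpace ℝ (Fin d) =>
      (G' q.1 x q.2 - G q.1 x q.2) * V q.2 * gaussWeierstrass d (t - q.1) q.2 y)
      (Ioo 0 t ×ˢ univ) volume := by
    intro t ht y
    refine ((hG' t ht x y).1.sub (hG t ht x y).1).congr (ae_of_all _ fun q => ?_)
    simp only [Pi.sub_apply]
    ring
  have hu_eq : ∀ t y, u t y = ∫⁻ q in Ioo 0 t ×ˢ univ,
      ‖(G' q.1 x q.2 - G q.1 x q.2) * V q.2 * gaussWeierstrass d (t - q.1) q.2 y‖ₑ := by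
    intro t y
    refine setLIntegral_congr_fun (hS t) fun q hq => ?_
    have hg := gaussWeierstrass_pos (sub_pos.2 hq.1.2) q.2 y
    simp only [w, enorm_mul]
    rw [Real.enorm_eq_ofReal hg.le]
  have hu_top : ∀ t, 0 < t → ∀ y, u t y < ∞ := by
    intro t ht y
    rw [hu_eq]
    exact (hint t ht y).2
  have hH : ∀ t, 0 < t → ∀ y, ‖G' t x y - G t x y‖ₑ ≤ u t y := by
    intro t ht y
    have hdiff : G' t x y - G t x y = ∫ q in Ioo 0 t ×ˢ univ,
        (G' q.1 x q.2 - G q.1 x q.2) * V q.2 * gaussWeierstrass d (t - q.1) q.2 y := by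
      have h1 := setIntegral_prod (μ := (volume : Measure ℝ))
        (ν := (volume : Measure (EuclideanSpace ℝ (Fin d)))) _ (hG t ht x y).1
      have h2 := setIntegral_prod (μ := (volume : Measure ℝ))
        (ν := (volume : Measure (EuclideanSpace ℝ (Fin d)))) _ (hG' t ht x y).1
      simp only [Measure.restrict_univ] at h1 h2
      rw [(hG t ht x y).2, (hG' t ht x y).2, ← h1, ← h2, add_sub_add_left_eq_sub]
      refine (integral_sub (hG' t ht x y).1 (hG t ht x y).1).symm.trans ?_
      refine integral_congr_ae (ae_of_all _ fun q => ?_)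
      simp only
      ring
    rw [hdiff, hu_eq]
    exact enorm_integral_le_lintegral_enorm _
  -- Solutions are not assumed measurable; measurability of `w` is recovered by dividing the
  -- integrable integrand by the positive kernel.
  have hw : ∀ t, 0 < t → AEMeasurable w (volume.restrict (Ioo 0 t ×ˢ univ)) := by
    intro t ht
    have hgm : Measurable fun q : ℝ × EuclideanSpace ℝ (Fin d) =>
        (gaussWeierstrass d (t - q.1) q.2 y)⁻¹ :=
      (Measurable.gaussWeierstrass (by fun_prop) (by fun_prop) (by fun_prop)).inv
    refine AEMeasurable.congr
      ((hint t ht y).1.aemeasurable.mul hgm.aemeasurable).enorm ?_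
    filter_upwards [ae_restrict_mem (hS t)] with q hq
    have hg := gaussWeierstrass_pos (sub_pos.2 hq.1.2) q.2 y
    simp only [w, Pi.mul_apply]
    rw [mul_inv_cancel_right₀ hg.ne']
  have hle : u t y ≤ ENNReal.ofReal η * u t y := by
    refine le_trans ?_ (lintegral_lintegral_bridge_le hV hη h y (hw t ht))
    refine setLIntegral_mono' (hS t) fun q hq => ?_
    have hg := gaussWeierstrass_pos (sub_pos.2 hq.1.2) q.2 y
    have hwq : w q ≤ u q.1 q.2 * ENNReal.ofReal |V q.2| := by
      rw [← Real.norm_eq_abs, ofReal_norm]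
      simp only [w, enorm_mul _ (V q.2)]
      gcongr
      exact hH q.1 hq.1.1 q.2
    rw [ENNReal.ofReal_mul (abs_nonneg _), ← mul_assoc]
    gcongr
  have hu0 : u t y = 0 := by
    by_contra hne
    have : ENNReal.ofReal η * u t y < 1 * u t y :=
      ENNReal.mul_lt_mul_left hne (hu_top t ht y).ne (by simpa using hη1)
    rw [one_mul] at this
    exact absurd hle (not_le.2 this)
  have := hH t ht y
  rw [hu0, nonpos_iff_eq_zero, enorm_eq_zero, sub_eq_zero] at this
  exact this

/-- A potential with small bridge potential has the global sharp Gaussian estimates. -/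
theorem BridgePotentialLE.hasGlobalSharpGaussianEstimates (hV : Measurable V) {η : ℝ}
    (hη : 0 ≤ η) (hη1 : η < 1 / 2) (h : BridgePotentialLE V η) :
    HasGlobalSharpGaussianEstimates V := by
  have hη' : η < 1 := by linarith
  -- This is where `η < 1/2` is needed: it makes the lower constant positive.
  have hlt : η / (1 - η) < 1 := by rw [div_lt_one] <;> linarith
  have hnn : 0 ≤ η / (1 - η) := div_nonneg hη (by linarith)
  have hG := satisfiesDuhamel_perturbationSeries hV hη hη' h
  refine ⟨perturbationSeries V, ⟨hG, fun G' hG' t ht x y =>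
    hG.eq_of_bridgePotentialLE hV hη hη' h hG' ht x y⟩,
    1 - η / (1 - η), 1 + η / (1 - η), by linarith, by linarith, fun t ht x y => ?_⟩
  have hg := gaussWeierstrass_pos ht x y
  have hb := abs_le.1 (abs_perturbationSeries_sub_le hV hη hη' h x ht y)
  rw [le_div_iff₀ hg, div_le_iff₀ hg]
  constructor <;> nlinarith [hb.1, hb.2]

end

/-! ### Time integral of the mass of a thin box -/

/-- Cutting at `r²` and `R²` and using one bound on each piece gives `r²`, `4r² log(R/r)` and `6r²`.
-/
theorem setLIntegral_Ioi_le_of_piecewise {r R : ℝ} (hr : 0 < r) (hrR : r ≤ R) {f : ℝ → ℝ≥0∞}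
    (h1 : ∀ s, 0 < s → f s ≤ 1) (h2 : ∀ s, 0 < s → f s ≤ ENNReal.ofReal (2 * r ^ 2 * s⁻¹))
    (h3 : ∀ s, 0 < s → f s ≤ ENNReal.ofReal (3 * r ^ 2 * R * s ^ (-(3 / 2) : ℝ))) :
    ∫⁻ s in Ioi 0, f s ≤ ENNReal.ofReal (r ^ 2 * (7 + 4 * Real.log (R / r))) := by
  have hR : 0 < R := hr.trans_le hrR
  have hr2 : 0 < r ^ 2 := by positivity
  have hR2 : 0 < R ^ 2 := by positivity
  have hrR2 : r ^ 2 ≤ R ^ 2 := by gcongr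
  have hlog : 0 ≤ Real.log (R / r) := Real.log_nonneg ((one_le_div hr).2 hrR)
  have hsplit : (Ioi 0 : Set ℝ) = Ioc 0 (r ^ 2) ∪ (Ioc (r ^ 2) (R ^ 2) ∪ Ioi (R ^ 2)) := by
    rw [Ioc_union_Ioi_eq_Ioi hrR2, Ioc_union_Ioi_eq_Ioi hr2.le]
  have e1 : ∫⁻ s in Ioc 0 (r ^ 2), f s ≤ ENNReal.ofReal (r ^ 2) := by
    refine (setLIntegral_mono' measurableSet_Ioc fun s hs => h1 s hs.1).trans ?_
    simp
  have e2 : ∫⁻ s in Ioc (r ^ 2) (R ^ 2), f s ≤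
      ENNReal.ofReal (4 * r ^ 2 * Real.log (R / r)) := by
    refine (setLIntegral_mono' measurableSet_Ioc fun s hs => h2 s (hr2.trans hs.1)).trans ?_
    have hii : IntervalIntegrable (fun s : ℝ => 2 * r ^ 2 * s⁻¹) volume (r ^ 2) (R ^ 2) :=
      (intervalIntegrable_inv_iff.2 (Or.inr (by
        rw [uIcc_of_le hrR2]; exact fun h => absurd h.1 (not_le.2 hr2)))).const_mul _
    rw [← ofReal_integral_eq_lintegral_ofReal
      ((intervalIntegrable_iff_integrableOn_Ioc_of_le hrR2).1 hii)]
    · rw [← intervalIntegral.integral_of_le hrR2, intervalIntegral.integral_const_mul,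
        integral_inv_of_pos hr2 hR2, ← div_pow, Real.log_pow]
      refine ENNReal.ofReal_le_ofReal (le_of_eq ?_)
      push_cast
      ring
    · filter_upwards [ae_restrict_mem measurableSet_Ioc] with s hs
      have : 0 < s := hr2.trans hs.1
      simp only [Pi.zero_apply]
      positivity
  have e3 : ∫⁻ s in Ioi (R ^ 2), f s ≤ ENNReal.ofReal (6 * r ^ 2) := by
    refine (setLIntegral_mono' measurableSet_Ioi fun s hs => h3 s (hR2.trans hs)).trans ?_
    rw [← ofReal_integral_eq_lintegral_ofReal
      ((integrableOn_Ioi_rpow_of_lt (by norm_num) hR2).const_mul _)]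
    · rw [integral_const_mul, integral_Ioi_rpow_of_lt (by norm_num) hR2]
      have hpow : (R ^ 2) ^ (-(3 / 2) + 1 : ℝ) = R⁻¹ := by
        rw [← Real.rpow_natCast R 2, ← Real.rpow_mul hR.le, ← Real.rpow_neg_one]
        norm_num
      rw [hpow]
      refine ENNReal.ofReal_le_ofReal (le_of_eq ?_)
      field_simp
      norm_num
    · filter_upwards [ae_restrict_mem measurableSet_Ioi] with s hs
      have : 0 < s := hR2.trans hs
      simp only [Pi.zero_apply]
      positivity
  rw [hsplit]
  refine (lintegral_union_le _ _ _).trans ((add_le_add_right (lintegral_union_le _ _ _) _).trans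
    ((add_le_add e1 (add_le_add e2 e3)).trans (le_of_eq ?_)))
  rw [← ENNReal.ofReal_add (by positivity) (by positivity),
    ← ENNReal.ofReal_add (by positivity) (by positivity)]
  congr 1
  ring

theorem setLIntegral_Ioo_comp_sub (f : ℝ → ℝ≥0∞) (t : ℝ) :
    ∫⁻ s in Ioo 0 t, f (t - s) = ∫⁻ s in Ioo 0 t, f s := by
  rw [← lintegral_indicator measurableSet_Ioo, ← lintegral_indicator measurableSet_Ioo,
    ← lintegral_sub_left_eq_self _ t]
  refine lintegral_congr fun s => ?_
  simp [indicator, and_comm]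

/-- The decay profile of the heat kernel mass of a long thin box. -/
noncomputable def boxDecay (r R τ : ℝ) : ℝ := min 1 (r / √τ) ^ 2 * min 1 (R / √τ)

theorem boxDecay_anti {r R : ℝ} (hr : 0 ≤ r) (hR : 0 ≤ R) {σ τ : ℝ} (hσ : 0 < σ) (h : σ ≤ τ) :
    boxDecay r R τ ≤ boxDecay r R σ := by
  unfold boxDecay
  have h0 : 0 < √σ := Real.sqrt_pos.2 hσ
  have h1 : √σ ≤ √τ := Real.sqrt_le_sqrt h
  have h2 : 0 ≤ min 1 (R / √τ) := le_min zero_le_one (by positivity)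
  have h3 : 0 ≤ min 1 (r / √τ) := le_min zero_le_one (by positivity)
  gcongr

theorem setLIntegral_boxDecay_half_le {r R : ℝ} (hr : 0 < r) (hrR : r ≤ R) :
    ∫⁻ s in Ioi 0, ENNReal.ofReal (boxDecay r R (s / 2)) ≤
      ENNReal.ofReal (r ^ 2 * (7 + 4 * Real.log (R / r))) := by
  have hR : 0 < R := hr.trans_le hrR
  have hle1 : ∀ {a τ : ℝ}, min 1 (a / √τ) ≤ 1 := min_le_left _ _
  have hn : ∀ {a : ℝ}, 0 < a → ∀ τ, 0 ≤ min 1 (a / √τ) :=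
    fun ha τ => le_min zero_le_one (by positivity)
  refine setLIntegral_Ioi_le_of_piecewise hr hrR (fun s hs => ?_) (fun s hs => ?_) fun s hs => ?_
  · rw [← ENNReal.ofReal_one]
    refine ENNReal.ofReal_le_ofReal ?_
    exact mul_le_one₀ (pow_le_one₀ (hn hr _) hle1) (hn hR _) hle1
  · refine ENNReal.ofReal_le_ofReal ?_
    calc boxDecay r R (s / 2) ≤ (r / √(s / 2)) ^ 2 * 1 := by
          unfold boxDecay
          have h1 := hn hr (s / 2)
          gcongr
          · exact min_le_right _ _
          · exact hle1
      _ = 2 * r ^ 2 * s⁻¹ := by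
          rw [mul_one, div_pow, Real.sq_sqrt (by positivity)]
          field_simp
  · refine ENNReal.ofReal_le_ofReal ?_
    have hq : 0 < √s := Real.sqrt_pos.2 hs
    have hs2 : √s ^ 2 = s := Real.sq_sqrt hs.le
    have h3 : s ^ (-(3 / 2) : ℝ) = (√s ^ 3)⁻¹ := by
      rw [Real.rpow_neg hs.le, Real.sqrt_eq_rpow, ← Real.rpow_natCast, ← Real.rpow_mul hs.le]
      norm_num
    have h2 : 0 < √2 := by positivity
    have h22 : √2 ^ 2 = 2 := Real.sq_sqrt (by norm_num)
    calc boxDecay r R (s / 2) ≤ (r / √(s / 2)) ^ 2 * (R / √(s / 2)) := by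
          unfold boxDecay
          have h1 := hn hr (s / 2)
          have h2 := hn hR (s / 2)
          gcongr
          · exact min_le_right _ _
          · exact min_le_right _ _
      _ = (2 * √2) * r ^ 2 * R * (√s ^ 3)⁻¹ := by
          rw [Real.sqrt_div hs.le]
          field_simp
          rw [h22]
      -- `2√2 ≤ 3`.
      _ ≤ 3 * r ^ 2 * R * s ^ (-(3 / 2) : ℝ) := by
          rw [h3]
          gcongr
          nlinarith

/-- Since `s(t-s)/t ≥ min(s, t-s)/2` and the decay profile is antitone, the integrand is at most its
value at `s/2` plus its value at `(t-s)/2`; reflection makes the two integrals equal. -/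
theorem setLIntegral_boxDecay_bridge_le {r R t : ℝ} (hr : 0 < r) (hrR : r ≤ R) :
    ∫⁻ s in Ioo 0 t, ENNReal.ofReal (boxDecay r R (s * (t - s) / t)) ≤
      ENNReal.ofReal (2 * (r ^ 2 * (7 + 4 * Real.log (R / r)))) := by
  have hR : 0 < R := hr.trans_le hrR
  have hlog : 0 ≤ Real.log (R / r) := Real.log_nonneg ((one_le_div hr).2 hrR)
  set f : ℝ → ℝ≥0∞ := fun s => ENNReal.ofReal (boxDecay r R (s / 2)) with hf
  have hfm : Measurable f := by
    simp only [hf, boxDecay]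
    fun_prop
  have hfi : ∫⁻ s in Ioo 0 t, f s ≤ ENNReal.ofReal (r ^ 2 * (7 + 4 * Real.log (R / r))) :=
    (lintegral_mono_set Ioo_subset_Ioi_self).trans (setLIntegral_boxDecay_half_le hr hrR)
  calc _ ≤ ∫⁻ s in Ioo 0 t, (f s + f (t - s)) := by
        refine setLIntegral_mono' measurableSet_Ioo fun s hs => ?_
        obtain ⟨hs0, hst⟩ := hs
        have ht : 0 < t := hs0.trans hst
        rcases le_total s (t - s) with h | h
        · refine le_trans (ENNReal.ofReal_le_ofReal ?_) le_self_add
          refine boxDecay_anti hr.le hR.le (by positivity) ?_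
          rw [div_le_div_iff₀ two_pos ht]
          nlinarith
        · refine le_trans (ENNReal.ofReal_le_ofReal ?_) le_add_self
          refine boxDecay_anti hr.le hR.le (by linarith) ?_
          rw [div_le_div_iff₀ two_pos ht]
          nlinarith
    _ = (∫⁻ s in Ioo 0 t, f s) + ∫⁻ s in Ioo 0 t, f s := by
        rw [lintegral_add_left hfm, setLIntegral_Ioo_comp_sub f t]
    _ ≤ _ := by
        rw [two_mul, ENNReal.ofReal_add (by positivity) (by positivity)]
        exact add_le_add hfi hfi

/-- The bridge potential of the indicator of a set thin in two coordinates. -/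
theorem lintegral_bridge_indicator_le {d : ℕ} {i j k : Fin d} (hij : i ≠ j) (hik : i ≠ k)
    (hjk : j ≠ k) {r R : ℝ} (hr : 0 < r) (hrR : r ≤ R) {A : Set (EuclideanSpace ℝ (Fin d))}
    (hAm : MeasurableSet A) (hA : ∀ z ∈ A, |z i| < r ∧ |z j| < r ∧ |z k| < R) (t : ℝ)
    (x y : EuclideanSpace ℝ (Fin d)) :
    ∫⁻ q in Ioo 0 t ×ˢ univ, A.indicator (fun z => ENNReal.ofReal
      (gaussWeierstrass d q.1 x z * gaussWeierstrass d (t - q.1) z y)) q.2 ≤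
    ENNReal.ofReal (2 * (r ^ 2 * (7 + 4 * Real.log (R / r)))) *
      ENNReal.ofReal (gaussWeierstrass d t x y) := by
  have hm : Measurable fun q : ℝ × EuclideanSpace ℝ (Fin d) => A.indicator (fun z =>
      ENNReal.ofReal (gaussWeierstrass d q.1 x z * gaussWeierstrass d (t - q.1) z y)) q.2 := by
    have h0 : Measurable fun q : ℝ × EuclideanSpace ℝ (Fin d) =>
        ENNReal.ofReal (gaussWeierstrass d q.1 x q.2 * gaussWeierstrass d (t - q.1) q.2 y) :=
      ((Measurable.gaussWeierstrass (by fun_prop) (by fun_prop) (by fun_prop)).mul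
        (Measurable.gaussWeierstrass (by fun_prop) (by fun_prop) (by fun_prop))).ennreal_ofReal
    exact h0.indicator (measurable_snd hAm)
  rw [Measure.volume_eq_prod, ← Measure.prod_restrict, lintegral_prod _ hm.aemeasurable,
    Measure.restrict_univ]
  calc _ ≤ ∫⁻ s in Ioo 0 t, ENNReal.ofReal (boxDecay r R (s * (t - s) / t)) *
        ENNReal.ofReal (gaussWeierstrass d t x y) := by
        refine setLIntegral_mono' measurableSet_Ioo fun s hs => ?_
        have ht : 0 < t := hs.1.trans hs.2
        have hτ : 0 < s * (t - s) / t := div_pos (mul_pos hs.1 (sub_pos.2 hs.2)) ht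
        have hg := gaussWeierstrass_pos ht x y
        simp only
        rw [lintegral_indicator hAm]
        simp_rw [gaussWeierstrass_mul_gaussWeierstrass hs.1 hs.2 x y, ENNReal.ofReal_mul hg.le]
        rw [lintegral_const_mul' _ _ ENNReal.ofReal_ne_top, mul_comm]
        gcongr
        exact setLIntegral_gaussWeierstrass_le hτ _ hij hik hjk hr.le hA
    _ ≤ _ := by
        rw [lintegral_mul_const' _ _ ENNReal.ofReal_ne_top]
        gcongr
        exact setLIntegral_boxDecay_bridge_le hr hrR

/-! ### The potential and its bridge bound -/

noncomputable section

variable {d : ℕ}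

/-- Dyadic boxes of size `2⁻ⁿ` in two directions and `2ⁿ` in a third one. -/
def thinBox (i j k : Fin d) (n : ℕ) : Set (EuclideanSpace ℝ (Fin d)) :=
  {z | (1 / 2 : ℝ) ^ (n + 1) ≤ |z i| ∧ |z i| < (1 / 2 : ℝ) ^ n ∧ |z j| < (1 / 2 : ℝ) ^ n ∧
    |z k| < 2 ^ n}

/-- The height of the potential on the `n`-th box. -/
def boxHeight (n : ℕ) : ℝ := 4 ^ n / (128 * (n + 1) ^ 3)

/-- The potential concentrated along an axis. -/
def axisPotential (i j k : Fin d) (z : EuclideanSpace ℝ (Fin d)) : ℝ :=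
  ∑' n, (thinBox i j k n).indicator (fun _ => boxHeight n) z

theorem measurableSet_thinBox (i j k : Fin d) (n : ℕ) : MeasurableSet (thinBox i j k n) := by
  have h : ∀ l : Fin d, Measurable fun z : EuclideanSpace ℝ (Fin d) => |z l| := fun l => by fun_prop
  exact (measurableSet_le measurable_const (h i)).inter
    ((measurableSet_lt (h i) measurable_const).inter
      ((measurableSet_lt (h j) measurable_const).inter (measurableSet_lt (h k) measurable_const)))

theorem boxHeight_pos (n : ℕ) : 0 < boxHeight n := by
  unfold boxHeight
  positivity

/-- The dyadic shells in coordinate `i` are disjoint, so at most one term of `axisPotential` is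
nonzero at any point. -/
theorem eq_of_mem_thinBox {i j k : Fin d} {m n : ℕ} {z : EuclideanSpace ℝ (Fin d)}
    (hm : z ∈ thinBox i j k m) (hn : z ∈ thinBox i j k n) : m = n := by
  have key : ∀ {m n : ℕ}, z ∈ thinBox i j k m → z ∈ thinBox i j k n → n ≤ m := by
    intro m n hm hn
    have h : (1 / 2 : ℝ) ^ (m + 1) < (1 / 2) ^ n := hm.1.trans_lt hn.2.1
    exact Nat.lt_succ_iff.1 ((pow_lt_pow_iff_right_of_lt_one₀ (by norm_num) (by norm_num)).1 h)
  exact le_antisymm (key hn hm) (key hm hn)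

theorem axisPotential_of_mem {i j k : Fin d} {n : ℕ} {z : EuclideanSpace ℝ (Fin d)}
    (hz : z ∈ thinBox i j k n) : axisPotential i j k z = boxHeight n := by
  rw [axisPotential, tsum_eq_single n, indicator_of_mem hz]
  exact fun m hmn => indicator_of_notMem (fun hm => hmn (eq_of_mem_thinBox hm hz)) _

theorem measurable_axisPotential (i j k : Fin d) : Measurable (axisPotential i j k) := by
  unfold axisPotential
  exact Measurable.tsum fun n => measurable_const.indicator (measurableSet_thinBox i j k n)

theorem axisPotential_nonneg (i j k : Fin d) (z : EuclideanSpace ℝ (Fin d)) :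
    0 ≤ axisPotential i j k z :=
  tsum_nonneg fun n => indicator_nonneg (fun _ _ => (boxHeight_pos n).le) _

theorem ofReal_axisPotential_mul_le (i j k : Fin d) (z : EuclideanSpace ℝ (Fin d)) (a : ℝ≥0∞) :
    ENNReal.ofReal (axisPotential i j k z) * a ≤
      ∑' n, ENNReal.ofReal (boxHeight n) * (thinBox i j k n).indicator (fun _ => a) z := by
  by_cases h : ∃ n, z ∈ thinBox i j k n
  · obtain ⟨n, hn⟩ := h
    rw [axisPotential_of_mem hn]
    refine le_trans (le_of_eq ?_) (ENNReal.le_tsum n)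
    rw [indicator_of_mem hn]
  · push Not at h
    have : axisPotential i j k z = 0 := by
      rw [axisPotential]
      simp [indicator_of_notMem (h _)]
    simp [this]

theorem tsum_boxHeight_mul_le :
    ∑' n, ENNReal.ofReal (boxHeight n) * ENNReal.ofReal
      (2 * (((1 / 2 : ℝ) ^ n) ^ 2 * (7 + 4 * Real.log (2 ^ n / (1 / 2) ^ n)))) ≤
      ENNReal.ofReal (1 / 4) := by
  -- Since `7 + 8n ≤ 8(n+1)`, the `n`-th term is at most `16(n+1)/(128(n+1)³) = 1/(8(n+1)²)`; the
  -- sum is `π²/48 ≤ 1/4`.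
  have hz : HasSum (fun n : ℕ => (1 / 8 : ℝ) * (1 / ((n + 1 : ℕ) : ℝ) ^ 2))
      (1 / 8 * (Real.pi ^ 2 / 6)) := by
    refine HasSum.mul_left _ ?_
    have := (hasSum_nat_add_iff' 1).2 hasSum_zeta_two
    simpa using this
  have hpi : 1 / 8 * (Real.pi ^ 2 / 6) ≤ 1 / 4 := by
    nlinarith [Real.pi_lt_d2, Real.pi_pos]
  refine le_trans (ENNReal.tsum_le_tsum fun n => ?_) (le_trans (le_of_eq
    (ENNReal.ofReal_tsum_of_nonneg (fun n => by positivity) hz.summable).symm)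
    (ENNReal.ofReal_le_ofReal (hz.tsum_eq.trans_le hpi)))
  rw [← ENNReal.ofReal_mul (boxHeight_pos n).le]
  refine ENNReal.ofReal_le_ofReal ?_
  have hlog : Real.log (2 ^ n / (1 / 2) ^ n) ≤ 2 * n := by
    have : (2 : ℝ) ^ n / (1 / 2) ^ n = 2 ^ (2 * n) := by
      rw [← div_pow, pow_mul]
      norm_num
    rw [this, Real.log_pow]
    push_cast
    nlinarith [Real.log_two_lt_d9, (Nat.cast_nonneg n : (0 : ℝ) ≤ n)]
  have h4 : ((1 / 2 : ℝ) ^ n) ^ 2 = (4 ^ n)⁻¹ := by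
    rw [← pow_mul, mul_comm, pow_mul, ← inv_pow]
    norm_num
  calc _ ≤ boxHeight n * (2 * (((1 / 2 : ℝ) ^ n) ^ 2 * (7 + 4 * (2 * n)))) := by
        have := boxHeight_pos n
        gcongr
    _ ≤ boxHeight n * (2 * (((1 / 2 : ℝ) ^ n) ^ 2 * (8 * (n + 1)))) := by
        have := boxHeight_pos n
        gcongr
        linarith
    _ = _ := by
        rw [h4, boxHeight]
        push_cast
        field_simp
        norm_num

theorem bridgePotentialLE_of_abs_eq {i j k : Fin d} (hij : i ≠ j) (hik : i ≠ k) (hjk : j ≠ k)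
    {V : EuclideanSpace ℝ (Fin d) → ℝ} (hV : ∀ z, |V z| = axisPotential i j k z) :
    BridgePotentialLE V (1 / 4) := by
  intro t ht x y
  have hm : ∀ n, Measurable fun q : ℝ × EuclideanSpace ℝ (Fin d) =>
      (thinBox i j k n).indicator (fun z => ENNReal.ofReal
        (gaussWeierstrass d q.1 x z * gaussWeierstrass d (t - q.1) z y)) q.2 := by
    intro n
    have h0 : Measurable fun q : ℝ × EuclideanSpace ℝ (Fin d) =>
        ENNReal.ofReal (gaussWeierstrass d q.1 x q.2 * gaussWeierstrass d (t - q.1) q.2 y) :=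
      ((Measurable.gaussWeierstrass (by fun_prop) (by fun_prop) (by fun_prop)).mul
        (Measurable.gaussWeierstrass (by fun_prop) (by fun_prop) (by fun_prop))).ennreal_ofReal
    exact h0.indicator (measurable_snd (measurableSet_thinBox i j k n))
  calc _ ≤ ∫⁻ q in Ioo 0 t ×ˢ univ, ∑' n, ENNReal.ofReal (boxHeight n) *
        (thinBox i j k n).indicator (fun z => ENNReal.ofReal
          (gaussWeierstrass d q.1 x z * gaussWeierstrass d (t - q.1) z y)) q.2 := by
        refine lintegral_mono fun q => ?_
        simp only
        rw [hV, mul_right_comm, mul_comm, ENNReal.ofReal_mul (axisPotential_nonneg i j k q.2)]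
        exact ofReal_axisPotential_mul_le i j k q.2 _
    _ = ∑' n, ENNReal.ofReal (boxHeight n) * ∫⁻ q in Ioo 0 t ×ˢ univ,
        (thinBox i j k n).indicator (fun z => ENNReal.ofReal
          (gaussWeierstrass d q.1 x z * gaussWeierstrass d (t - q.1) z y)) q.2 := by
        rw [lintegral_tsum fun n => ((hm n).const_mul _).aemeasurable]
        simp_rw [lintegral_const_mul _ (hm _)]
    _ ≤ ∑' n, (ENNReal.ofReal (boxHeight n) * ENNReal.ofReal
          (2 * (((1 / 2 : ℝ) ^ n) ^ 2 * (7 + 4 * Real.log (2 ^ n / (1 / 2) ^ n))))) *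
          ENNReal.ofReal (gaussWeierstrass d t x y) := by
        refine ENNReal.tsum_le_tsum fun n => ?_
        rw [mul_assoc]
        gcongr
        refine lintegral_bridge_indicator_le hij hik hjk (by positivity) ?_
          (measurableSet_thinBox i j k n) (fun z hz => hz.2) t x y
        exact (pow_le_one₀ (by norm_num) (by norm_num)).trans (one_le_pow₀ (by norm_num))
    _ ≤ _ := by
        rw [ENNReal.tsum_mul_right, ENNReal.ofReal_mul (by norm_num)]
        gcongr
        exact tsum_boxHeight_mul_le

/-! ### Failure of integrability -/

theorem volume_setOf_forall_mem (s : Fin d → Set ℝ) (hs : ∀ l, MeasurableSet (s l)) :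
    volume {z : EuclideanSpace ℝ (Fin d) | ∀ l, z l ∈ s l} = ∏ l, volume (s l) := by
  have h : {z : EuclideanSpace ℝ (Fin d) | ∀ l, z l ∈ s l} =
      (WithLp.ofLp : EuclideanSpace ℝ (Fin d) → Fin d → ℝ) ⁻¹' univ.pi s := by
    ext z; simp
  rw [h, (PiLp.volume_preserving_ofLp (Fin d)).measure_preimage
    (MeasurableSet.univ_pi hs).nullMeasurableSet, volume_pi_pi]

/-- The part of a thin box in the positive orthant, cut at height `ρ` in the long direction. -/
def cutBox (i j k : Fin d) (n : ℕ) (ρ : ℝ) : Set (EuclideanSpace ℝ (Fin d)) :=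
  {z | ∀ l, z l ∈ if l = i then Ico ((1 / 2 : ℝ) ^ (n + 1)) ((1 / 2) ^ n)
    else if l = j then Ioo 0 ((1 / 2) ^ n) else if l = k then Ioo 0 ρ else Ioo 0 1}

theorem cutBox_subset_thinBox {i j k : Fin d} (hij : i ≠ j) (hik : i ≠ k) (hjk : j ≠ k) {n : ℕ}
    {ρ : ℝ} (hρ : ρ ≤ 2 ^ n) : cutBox i j k n ρ ⊆ thinBox i j k n := by
  intro z hz
  have hi := hz i
  have hj := hz j
  have hk := hz k
  simp only [if_true, hij.symm, hik.symm, hjk.symm, if_false] at hi hj hk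
  have hi0 : 0 < z i := lt_of_lt_of_le (by positivity) hi.1
  refine ⟨?_, ?_, ?_, ?_⟩
  · rw [abs_of_pos hi0]; exact hi.1
  · rw [abs_of_pos hi0]; exact hi.2
  · rw [abs_of_pos hj.1]; exact hj.2
  · rw [abs_of_pos hk.1]; exact hk.2.trans_le hρ

theorem cutBox_one_subset_closedBall (i j k : Fin d) (n : ℕ) :
    cutBox i j k n 1 ⊆ Metric.closedBall 0 √d := by
  intro z hz
  have h : ∀ l, z l ^ 2 ≤ 1 := by
    intro l
    have h1 : (1 / 2 : ℝ) ^ n ≤ 1 := pow_le_one₀ (by norm_num) (by norm_num)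
    have h2 : (0 : ℝ) < (1 / 2) ^ (n + 1) := by positivity
    have hl := hz l
    have : 0 ≤ z l ∧ z l ≤ 1 := by
      split_ifs at hl
      · exact ⟨(h2.trans_le hl.1).le, hl.2.le.trans h1⟩
      · exact ⟨hl.1.le, hl.2.le.trans h1⟩
      · exact ⟨hl.1.le, hl.2.le⟩
      · exact ⟨hl.1.le, hl.2.le⟩
    exact pow_le_one₀ this.1 this.2
  rw [mem_closedBall_zero_iff, EuclideanSpace.norm_eq]
  refine Real.sqrt_le_sqrt ?_
  calc ∑ l, ‖z l‖ ^ 2 ≤ ∑ _l : Fin d, (1 : ℝ) :=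
        Finset.sum_le_sum fun l _ => by rw [Real.norm_eq_abs, sq_abs]; exact h l
    _ = d := by simp

theorem measurableSet_cutBox (i j k : Fin d) (n : ℕ) (ρ : ℝ) :
    MeasurableSet (cutBox i j k n ρ) := by
  have : cutBox i j k n ρ = ⋂ l, (fun z : EuclideanSpace ℝ (Fin d) => z l) ⁻¹'
      (if l = i then Ico ((1 / 2 : ℝ) ^ (n + 1)) ((1 / 2) ^ n)
        else if l = j then Ioo 0 ((1 / 2) ^ n) else if l = k then Ioo 0 ρ else Ioo 0 1) := by
    ext z; simp [cutBox]
  rw [this]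
  refine MeasurableSet.iInter fun l => ?_
  have hl : Measurable fun z : EuclideanSpace ℝ (Fin d) => z l := by fun_prop
  refine hl ?_
  split_ifs <;> measurability

theorem volume_cutBox {i j k : Fin d} (hij : i ≠ j) (hik : i ≠ k) (hjk : j ≠ k) (n : ℕ) (ρ : ℝ) :
    volume (cutBox i j k n ρ) = ENNReal.ofReal ((1 / 4) ^ n / 2 * ρ) := by
  have hb : ∀ l : Fin d, volume (if l = i then Ico ((1 / 2 : ℝ) ^ (n + 1)) ((1 / 2) ^ n)
      else if l = j then Ioo 0 ((1 / 2) ^ n) else if l = k then Ioo 0 ρ else Ioo 0 1) =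
      (if l = i then ENNReal.ofReal ((1 / 2) ^ n / 2) else 1) *
      (if l = j then ENNReal.ofReal ((1 / 2) ^ n) else 1) *
      (if l = k then ENNReal.ofReal ρ else 1) := by
    intro l
    by_cases hi : l = i
    · subst hi
      simp only [if_true, hij, hik, if_false, mul_one, Real.volume_Ico]
      congr 1
      ring
    by_cases hj : l = j
    · subst hj
      simp [hij.symm, hjk]
    by_cases hk : l = k
    · subst hk
      simp [hik.symm, hjk.symm]
    simp [hi, hj, hk]
  rw [cutBox, volume_setOf_forall_mem _ fun l => by split_ifs <;> measurability]
  simp_rw [hb]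
  simp only [Finset.prod_mul_distrib, Finset.prod_ite_eq', Finset.mem_univ, if_true]
  rw [← ENNReal.ofReal_mul (by positivity), ← ENNReal.ofReal_mul (by positivity)]
  congr 2
  rw [div_mul_eq_mul_div, ← mul_pow]
  norm_num

/-- Exponential growth must beat the polynomial loss caused by the factor `(n+1)³` in `boxHeight`.
-/
theorem exists_pow_gt_mul_pow {c : ℝ} (hc : 1 < c) (C : ℝ) (m : ℕ) :
    ∃ n : ℕ, C * ((n : ℝ) + 1) ^ m < c ^ n := by
  have h := (tendsto_pow_const_div_const_pow_of_one_lt m hc).comp (Filter.tendsto_add_atTop_nat 1)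
  have h' := h.const_mul (C * c)
  rw [mul_zero] at h'
  obtain ⟨n, hn⟩ := (h'.eventually (gt_mem_nhds one_pos)).exists
  refine ⟨n, ?_⟩
  have hc0 : 0 < c := by linarith
  simp only [Function.comp, Nat.cast_add, Nat.cast_one, pow_succ c] at hn
  rw [mul_div_assoc', div_lt_one (by positivity)] at hn
  nlinarith

/-- Chebyshev's inequality on one box at a time: height to the power `p` times volume is bounded by
the `p`-th power of the norm, yet grows like `cⁿ` up to a polynomial. The bound `p ≤ 2` keeps that
polynomial at degree 6, independent of `p`. -/
theorem not_memLp_axisPotential {i j k : Fin d} (hij : i ≠ j) (hik : i ≠ k) (hjk : j ≠ k)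
    {p : ℝ≥0∞} (hp1 : 1 ≤ p) (hp2 : p ≤ 2) {S : Set (EuclideanSpace ℝ (Fin d))} {ρ : ℕ → ℝ}
    (hρ : ∀ n, ρ n ≤ 2 ^ n) (hS : ∀ n, cutBox i j k n (ρ n) ⊆ S) {c : ℝ} (hc : 1 < c)
    (hgrow : ∀ n, c ^ n ≤ (4 ^ n : ℝ) ^ p.toReal * ((1 / 4) ^ n * ρ n)) :
    ¬ MemLp (axisPotential i j k) p (volume.restrict S) := by
  intro hmem
  have hp0 : p ≠ 0 := (zero_lt_one.trans_le hp1).ne'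
  have hptop : p ≠ ∞ := (hp2.trans_lt (by simp)).ne
  have hp2' : p.toReal ≤ 2 := ENNReal.toReal_mono (by simp) hp2
  have hp1' : 0 < p.toReal := ENNReal.toReal_pos hp0 hptop
  set C := eLpNorm (axisPotential i j k) p (volume.restrict S) ^ p.toReal with hC
  have hCtop : C ≠ ∞ := ENNReal.rpow_ne_top_of_nonneg hp1'.le hmem.2.ne
  -- `128² (n+1)⁶` is the square of the denominator of `boxHeight`; the factor `2` offsets the `1/2`
  -- in the volume of `cutBox`.
  obtain ⟨n, hn⟩ := exists_pow_gt_mul_pow hc (C.toReal * (2 * 128 ^ 2)) 6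
  have hρ0 : 0 < ρ n := by
    have h1 : 0 < c ^ n := pow_pos (by linarith) n
    by_contra hle
    push Not at hle
    have : (4 ^ n : ℝ) ^ p.toReal * ((1 / 4) ^ n * ρ n) ≤ 0 :=
      mul_nonpos_of_nonneg_of_nonpos (by positivity)
        (mul_nonpos_of_nonneg_of_nonpos (by positivity) hle)
    linarith [hgrow n]
  have h := mul_meas_ge_le_pow_eLpNorm' (volume.restrict S) hp0 hptop hmem.1
    (ENNReal.ofReal (boxHeight n))
  have hsub : cutBox i j k n (ρ n) ⊆
      {z | ENNReal.ofReal (boxHeight n) ≤ ‖axisPotential i j k z‖ₑ} := by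
    intro z hz
    rw [mem_ofPred_eq, axisPotential_of_mem (cutBox_subset_thinBox hij hik hjk (hρ n) hz),
      Real.enorm_eq_ofReal (boxHeight_pos n).le]
  have h1 : ENNReal.ofReal (boxHeight n ^ p.toReal * ((1 / 4) ^ n / 2 * ρ n)) ≤ C := by
    refine le_trans (le_of_eq ?_) ((mul_le_mul_right (measure_mono hsub) _).trans h)
    rw [Measure.restrict_apply (measurableSet_cutBox _ _ _ _ _), inter_eq_left.2 (hS n),
      volume_cutBox hij hik hjk, ENNReal.ofReal_mul (by have := boxHeight_pos n; positivity),
      ENNReal.ofReal_rpow_of_pos (boxHeight_pos n)]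
  have h2 := (ENNReal.ofReal_le_iff_le_toReal hCtop).1 h1
  set D : ℝ := 128 * (n + 1) ^ 3 with hD
  have hD1 : 1 ≤ D := by
    have : (1 : ℝ) ≤ (n + 1) ^ 3 := one_le_pow₀ (by linarith [(Nat.cast_nonneg n : (0 : ℝ) ≤ n)])
    linarith
  have hDp : D ^ p.toReal ≤ D ^ 2 := by
    rw [← Real.rpow_natCast]
    exact Real.rpow_le_rpow_of_exponent_le hD1 (by exact_mod_cast hp2')
  have hDp0 : 0 < D ^ p.toReal := by positivity
  rw [boxHeight, Real.div_rpow (by positivity) (by positivity), div_mul_eq_mul_div,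
    div_le_iff₀ hDp0] at h2
  have h3 : C.toReal * D ^ p.toReal ≤ C.toReal * D ^ 2 := by gcongr
  have h4 : C.toReal * D ^ 2 * 2 = C.toReal * (2 * 128 ^ 2) * (n + 1) ^ 6 := by
    rw [hD]; ring
  have h5 := hgrow n
  nlinarith

theorem not_memLp_one_axisPotential {i j k : Fin d} (hij : i ≠ j) (hik : i ≠ k) (hjk : j ≠ k) :
    ¬ MemLp (axisPotential i j k) 1 volume := by
  rw [← Measure.restrict_univ (μ := volume)]
  refine not_memLp_axisPotential hij hik hjk le_rfl (by norm_num) (ρ := fun n => 2 ^ n)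
    (fun n => le_rfl) (fun n => subset_univ _) one_lt_two fun n => ?_
  rw [ENNReal.toReal_one, Real.rpow_one, ← mul_pow, ← mul_pow]
  norm_num

/-- On a ball of finite measure `L^p` embeds in `L^(min p 2)`, which also covers `p = ∞`. The radius
`√d` suffices for the parts of the boxes in the unit cube, and the growth rate is `4^(q-1)` with `q
= min p 2 > 1`. -/
theorem not_memLpLoc_axisPotential {i j k : Fin d} (hij : i ≠ j) (hik : i ≠ k) (hjk : j ≠ k)
    {p : ℝ≥0∞} (hp : 1 < p) : ¬ MemLpLoc (axisPotential i j k) p := by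
  intro h
  have hK := h (Metric.closedBall 0 √d) (isCompact_closedBall _ _)
  have : IsFiniteMeasure
      (volume.restrict (Metric.closedBall (0 : EuclideanSpace ℝ (Fin d)) √d)) :=
    ⟨by simpa using measure_closedBall_lt_top⟩
  have hK' := hK.mono_exponent (min_le_left p 2)
  have hq : 1 < min p 2 := lt_min hp (by norm_num)
  have hq' : 1 < (min p 2).toReal := by
    rw [← ENNReal.toReal_one]
    exact (ENNReal.toReal_lt_toReal (by simp) (by simp)).2 hq
  refine not_memLp_axisPotential hij hik hjk hq.le (min_le_right p 2) (ρ := fun _ => 1)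
    (fun n => one_le_pow₀ (by norm_num)) (fun n => cutBox_one_subset_closedBall i j k n)
    (c := 4 ^ ((min p 2).toReal - 1)) (Real.one_lt_rpow (by norm_num) (by linarith))
    (fun n => le_of_eq ?_) hK'
  rw [← Real.rpow_natCast, ← Real.rpow_mul (by norm_num), ← Real.rpow_natCast 4 n,
    ← Real.rpow_mul (by norm_num), mul_one, one_div, inv_pow, ← Real.rpow_natCast,
    ← Real.rpow_neg (by norm_num), ← Real.rpow_add (by norm_num)]
  congr 1
  ring

end

theorem mainTheorem3 (d : ℕ) (hd : 3 ≤ d) :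
    (∃ V : EuclideanSpace ℝ (Fin d) → ℝ,
      Measurable V ∧ (∀ x, V x ≤ 0) ∧ HasGlobalSharpGaussianEstimates V ∧
      ¬ MemLp V 1 volume ∧ ∀ p : ℝ≥0∞, 1 < p → ¬ MemLpLoc V p) ∧
    (∃ V : EuclideanSpace ℝ (Fin d) → ℝ,
      Measurable V ∧ (∀ x, 0 ≤ V x) ∧ HasGlobalSharpGaussianEstimates V ∧
      ¬ MemLp V 1 volume ∧ ∀ p : ℝ≥0∞, 1 < p → ¬ MemLpLoc V p) := by
  let i : Fin d := ⟨0, by omega⟩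
  let j : Fin d := ⟨1, by omega⟩
  let k : Fin d := ⟨2, by omega⟩
  have hij : i ≠ j := by simp [i, j]
  have hik : i ≠ k := by simp [i, k]
  have hjk : j ≠ k := by simp [j, k]
  have hm := measurable_axisPotential i j k
  have h0 := axisPotential_nonneg i j k
  refine ⟨⟨fun z => -axisPotential i j k z, hm.neg, fun z => neg_nonpos.2 (h0 z), ?_, ?_, ?_⟩,
    axisPotential i j k, hm, h0, ?_, not_memLp_one_axisPotential hij hik hjk,
    fun p hp => not_memLpLoc_axisPotential hij hik hjk hp⟩
  · exact (bridgePotentialLE_of_abs_eq hij hik hjk fun z => by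
      rw [abs_neg, abs_of_nonneg (h0 z)]).hasGlobalSharpGaussianEstimates hm.neg
      (by norm_num) (by norm_num)
  · exact fun h => not_memLp_one_axisPotential hij hik hjk (memLp_neg_iff.1 h)
  · exact fun p hp h => not_memLpLoc_axisPotential hij hik hjk hp
      fun K hK => memLp_neg_iff.1 (h K hK)
  · exact (bridgePotentialLE_of_abs_eq hij hik hjk fun z =>
      abs_of_nonneg (h0 z)).hasGlobalSharpGaussianEstimates hm (by norm_num) (by norm_num)
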